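/- For integers $r,s,k\ge 0$ let $N_{\rm bi}(r,s,k)$ be the number of connected spanning subgraphs with exactly $r+s-1+k$ edges of the complete bipartite graph $K_{r,s}$ with labeled vertices, and put $$N_{\rm bi}(n,k)=\sum_{r+s=n}\binom{n}{r}N_{\rm bi}(r,s,k),$$ so that $N_{\rm bi}(n,1)$ is the number of connected bipartite unicyclic graphs on $n$ labeled vertices, each taken together with an ordered bipartition $(V_1,V_2)$ of its vertex set (every such graph is thus counted exactly twice). Let $N(n,1)$ be the number of all connected simple graphs with $n$ labeled vertices and $n$ edges (unicycles). Then for every integer $n\ge 4$, $$N_{\rm bi}(n,1)=n^{n-1}\sum_{2\le k\le n/2}\frac{n!}{(n-2k)!\,n^{2k}},$$ and, as $n\to\infty$, $$N_{\rm bi}(n,1)\sim\sqrt{\frac{\pi}{8}}\;n^{n-1/2}.$$ This is the same leading term as for all unicycles: $N(n,1)\sim\sqrt{\pi/8}\;n^{n-1/2}$ as $n\to\infty$. -/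

import Mathlib

/-- `N(n, k)`: the number of connected simple graphs on `n` labeled vertices with Betti number `k`,
that is, with `n - 1 + k` edges. -/
noncomputable def numConnected (n k : ℕ) : ℕ :=
  Nat.card {G : SimpleGraph (Fin n) // G.Connected ∧ G.edgeSet.ncard + 1 = n + k}

/-- `N_bi(r, s, k)`: the number of connected spanning subgraphs of the complete bipartite graph
`K_{r,s}` (labeled vertices, fixed parts of sizes `r` and `s`) with Betti number `k`, that is, with
`r + s - 1 + k` edges. -/
noncomputable def numConnectedBipartiteParts (r s k : ℕ) : ℕ :=
  Nat.card {G : SimpleGraph (Fin r ⊕ Fin s) //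
    G ≤ completeBipartiteGraph (Fin r) (Fin s) ∧ G.Connected ∧
      G.edgeSet.ncard + 1 = r + s + k}

/-- `N_bi(n, k) = ∑_{r + s = n} (n choose r) N_bi(r, s, k)`: the number of connected bipartite
graphs with Betti number `k` on `n` labeled vertices, together with an ordered bipartition
`V = V₁ ⊔ V₂`. -/
noncomputable def numConnectedBipartite (n k : ℕ) : ℕ :=
  ∑ p ∈ Finset.HasAntidiagonal.antidiagonal n, n.choose p.1 * numConnectedBipartiteParts p.1 p.2 k

/-! Orienting the cycle of a unicyclic graph and pointing every other vertex towards it turns the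
graph into a self-map with connected functional graph and cycle length at least 3. Each graph arises
from exactly two maps, so both counts reduce to counting maps with a cycle of length `l`.

Cutting the cycle open leaves a rooted forest with `l` roots, and rooted forests satisfy a
double-counting recurrence in the number of roots (`forestMaps_recurrence`). With
`mul_card_cycleMaps` this gives `n ^ (n - 1) * fallingRatio n l` maps. A unicyclic graph has two
ordered bipartitions if its cycle is even and none otherwise. These two cancel the two orientations,
so `N_bi(n, 1)` is the sum over even `l ≥ 4`, while `N(n, 1)` is half the sum over all `l ≥ 3`.

The full sum of `fallingRatio n k` is asymptotic to `√(π n / 2)`, by comparison with a Gaussian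
integral (`tendsto_ramanujanSum`). The terms decrease in `k` and are at most 1, so the even terms
carry half of the sum up to a bounded error. Hence both counts have the same leading term. -/

open Function

/-- A self-map all of whose orbits end in a fixed point, i.e. the parent map of a rooted forest
whose roots are the fixed points. -/
def IsForestMap {V : Type*} (f : V → V) : Prop := ∀ v, ∃ m, IsFixedPt f (f^[m] v)

/-! ### Cutting and grafting trees of a rooted forest -/

section Iterate

variable {V : Type*}

lemma iterate_eq_of_agree {f g : V → V} {w : V} {m : ℕ}
    (h : ∀ i < m, g (f^[i] w) = f (f^[i] w)) : g^[m] w = f^[m] w := by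
  induction m with
  | zero => rfl
  | succ m ih =>
    rw [iterate_succ_apply', iterate_succ_apply', ih fun i hi => h i (by omega),
      h m (by omega)]

lemma isFixedPt_iterate_of_le {f : V → V} {w : V} {m i : ℕ} (h : IsFixedPt f (f^[m] w))
    (hi : m ≤ i) : f^[i] w = f^[m] w := by
  obtain ⟨k, rfl⟩ := Nat.exists_eq_add_of_le hi
  rw [add_comm, iterate_add_apply]
  exact h.iterate k

lemma isFixedPt_iterate_unique {f : V → V} {w : V} {i j : ℕ} (hi : IsFixedPt f (f^[i] w))
    (hj : IsFixedPt f (f^[j] w)) : f^[i] w = f^[j] w := by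
  rcases le_total i j with h | h
  · exact (isFixedPt_iterate_of_le hi h).symm
  · exact isFixedPt_iterate_of_le hj h

lemma IsForestMap.isFixedPt_of_isPeriodicPt {f : V → V} (hf : IsForestMap f) {r : V} {m : ℕ}
    (hm : 0 < m) (h : IsPeriodicPt f m r) : IsFixedPt f r := by
  obtain ⟨k, hk⟩ := hf r
  have h1 : f^[m * k] r = f^[k] r := isFixedPt_iterate_of_le hk (Nat.le_mul_of_pos_left k hm)
  rw [(h.mul_const k).eq] at h1
  rwa [← h1] at hk

variable [DecidableEq V]

lemma iterate_update_of_avoid (f : V → V) {r : V} (v : V) {w : V} {m : ℕ}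
    (h : ∀ i < m, f^[i] w ≠ r) : (update f r v)^[m] w = f^[m] w :=
  iterate_eq_of_agree fun i hi => update_of_ne (h i hi) v f

lemma exists_iterate_update_eq (f : V → V) {r : V} (v : V) {w : V} (h : ∃ m, f^[m] w = r) :
    ∃ m, (update f r v)^[m] w = r := by
  -- Up to the first visit to `r` the orbit never uses the changed value.
  refine ⟨Nat.find h, ?_⟩
  rw [iterate_update_of_avoid f v fun i hi => Nat.find_min h hi]
  exact Nat.find_spec h

/-- Orbits that avoid `r` are unchanged, and this includes the orbit of `v`; an orbit that meets `r`
continues along that of `v`. -/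
lemma IsForestMap.update_graft {f : V → V} (hf : IsForestMap f) {r v : V} (hv : ∀ m, f^[m] v ≠ r) :
    IsForestMap (update f r v) := by
  have key : ∀ w, (∀ m, f^[m] w ≠ r) → ∃ m, IsFixedPt (update f r v) ((update f r v)^[m] w) := by
    intro w hw
    obtain ⟨m, hm⟩ := hf w
    refine ⟨m, ?_⟩
    rw [iterate_update_of_avoid f v fun i _ => hw i]
    unfold IsFixedPt
    rw [update_of_ne (hw m)]
    exact hm
  intro w
  by_cases h : ∃ m, f^[m] w = r
  · obtain ⟨m, hm⟩ := exists_iterate_update_eq f v h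
    obtain ⟨k, hk⟩ := key v hv
    refine ⟨k + (1 + m), ?_⟩
    rw [iterate_add_apply, iterate_add_apply, hm, iterate_one, update_self]
    exact hk
  · push Not at h
    exact key w h

lemma IsForestMap.update_cut {g : V → V} (hg : IsForestMap g) (r : V) :
    IsForestMap (update g r r) := by
  intro w
  by_cases h : ∃ m, g^[m] w = r
  · obtain ⟨m, hm⟩ := exists_iterate_update_eq g r h
    exact ⟨m, by rw [hm]; exact update_self ..⟩
  · push Not at h
    obtain ⟨m, hm⟩ := hg w
    refine ⟨m, ?_⟩
    rw [iterate_update_of_avoid g r fun i _ => h i]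
    unfold IsFixedPt
    rw [update_of_ne (h m)]
    exact hm

/-- If the old parent of `r` still led to `r` after the cut, restoring the edge would put `r` on a
cycle of the forest. This makes cutting inverse to grafting. -/
lemma IsForestMap.iterate_update_cut_ne {g : V → V} (hg : IsForestMap g) {r : V} (hr : g r ≠ r)
    (m : ℕ) : (update g r r)^[m] (g r) ≠ r := by
  intro h
  have h' := exists_iterate_update_eq (update g r r) (g r) ⟨m, h⟩
  rw [update_idem, update_eq_self] at h'
  obtain ⟨k, hk⟩ := h'
  exact hr (hg.isFixedPt_of_isPeriodicPt k.succ_pos (by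
    unfold IsPeriodicPt IsFixedPt; rwa [iterate_succ_apply]))

end Iterate

/-! ### Counting rooted forests by number of roots -/

section Forest

open scoped Classical

variable (V : Type*) [Fintype V]

/-- Parent maps of rooted forests with `k` roots. -/
noncomputable def forestMaps (k : ℕ) : Finset (V → V) :=
  {f | IsForestMap f ∧ (Finset.univ.filter fun v => f v = v).card = k}

variable {V}

lemma card_fixed_not_reached {f : V → V} {k : ℕ} (hf : f ∈ forestMaps V k) (v : V) :
    (Finset.univ.filter fun r => f r = r ∧ ∀ m, f^[m] v ≠ r).card = k - 1 := by
  simp only [forestMaps, Finset.mem_filter, Finset.mem_univ, true_and] at hf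
  obtain ⟨m, hm⟩ := hf.1 v
  rw [← hf.2, ← Finset.card_erase_of_mem (a := f^[m] v) (by simpa using hm.eq)]
  congr 1
  ext r
  simp only [Finset.mem_filter, Finset.mem_univ, true_and, Finset.mem_erase]
  constructor
  · rintro ⟨h1, h2⟩
    exact ⟨(h2 m).symm, h1⟩
  · rintro ⟨h1, h2⟩
    refine ⟨h2, fun j hj => h1 ?_⟩
    subst hj
    exact isFixedPt_iterate_unique h2 hm

lemma card_fixed_update_cut (g : V → V) {r : V} (hr : g r ≠ r) :
    (Finset.univ.filter fun v => update g r r v = v).card =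
      (Finset.univ.filter fun v => g v = v).card + 1 := by
  rw [← Finset.card_insert_of_notMem (a := r) (by simpa using hr)]
  congr 1
  ext v
  by_cases h : v = r
  · subst h; simp
  · simp [h]

/-- Double counting: hanging a root `r` below a vertex `v` of another tree lowers the number of
roots by one, and cutting a non-root `r` off its parent undoes this. From `k + 1` roots there are
`n` choices of `v` and then `k` of `r`; from `k` roots there are `n - k` choices of `r`. -/
lemma forestMaps_recurrence (k : ℕ) :
    Fintype.card V * k * (forestMaps V (k + 1)).card =
      (Fintype.card V - k) * (forestMaps V k).card := by
  have h1 : ((forestMaps V (k + 1) ×ˢ (Finset.univ : Finset V)).sigma fun p =>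
      Finset.univ.filter fun r => p.1 r = r ∧ ∀ m, p.1^[m] p.2 ≠ r).card =
      Fintype.card V * k * (forestMaps V (k + 1)).card := by
    rw [Finset.card_sigma, Finset.sum_congr rfl fun p hp =>
      card_fixed_not_reached (Finset.mem_product.1 hp).1 p.2]
    simp only [Finset.sum_const, Finset.card_product, Finset.card_univ, smul_eq_mul]
    simp; ring
  have h2 : ((forestMaps V k).sigma fun g => Finset.univ.filter fun r => g r ≠ r).card =
      (Fintype.card V - k) * (forestMaps V k).card := by
    rw [Finset.card_sigma, Finset.sum_const_nat (m := Fintype.card V - k), mul_comm]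
    intro g hg
    simp only [forestMaps, Finset.mem_filter, Finset.mem_univ, true_and] at hg
    rw [Finset.filter_not, Finset.card_sdiff_of_subset (Finset.filter_subset _ _), hg.2,
      Finset.card_univ]
  rw [← h1, ← h2]
  refine Finset.card_bij' (fun p _ => ⟨update p.1.1 p.2 p.1.2, p.2⟩)
    (fun q _ => ⟨(update q.1 q.2 q.2, q.1 q.2), q.2⟩) ?_ ?_ ?_ ?_
  · rintro ⟨⟨f, v⟩, r⟩ hp
    simp only [forestMaps, Finset.mem_sigma, Finset.mem_product, Finset.mem_filter,
      Finset.mem_univ, true_and, and_true] at hp ⊢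
    obtain ⟨⟨hf, hk⟩, hr, hv⟩ := hp
    have hvr : v ≠ r := hv 0
    have := card_fixed_update_cut (update f r v) (r := r) (by simpa using hvr)
    have h3 : update f r r = f := by rw [update_eq_iff]; exact ⟨hr.symm, fun _ _ => rfl⟩
    rw [update_idem, h3, hk] at this
    exact ⟨⟨hf.update_graft hv, by omega⟩, by simpa using hvr⟩
  · rintro ⟨g, r⟩ hq
    simp only [forestMaps, Finset.mem_sigma, Finset.mem_product, Finset.mem_filter,
      Finset.mem_univ, true_and, and_true] at hq ⊢
    obtain ⟨⟨hg, hk⟩, hr⟩ := hq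
    exact ⟨⟨hg.update_cut r, by rw [card_fixed_update_cut g hr, hk]⟩, by simp,
      hg.iterate_update_cut_ne hr⟩
  · rintro ⟨⟨f, v⟩, r⟩ hp
    simp only [Finset.mem_sigma, Finset.mem_filter, Finset.mem_univ, true_and] at hp
    have h3 : update f r r = f := by rw [update_eq_iff]; exact ⟨hp.2.1.symm, fun _ _ => rfl⟩
    simp [h3]
  · rintro ⟨g, r⟩ hq
    simp

lemma card_forestMaps_card : (forestMaps V (Fintype.card V)).card = 1 := by
  rw [Finset.card_eq_one]
  refine ⟨id, ?_⟩
  ext f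
  simp only [forestMaps, Finset.mem_filter, Finset.mem_univ, true_and, Finset.mem_singleton]
  constructor
  · rintro ⟨-, h⟩
    rw [Finset.card_eq_iff_eq_univ] at h
    funext v
    simpa using h.ge (Finset.mem_univ v)
  · rintro rfl
    exact ⟨fun v => ⟨0, rfl⟩, by simp⟩

/-- The number of rooted forests with `k` roots on `n` labeled vertices is
`n.choose k * k * n ^ (n - k - 1)`. -/
lemma card_forestMaps {k : ℕ} (hk : 1 ≤ k) (hkn : k ≤ Fintype.card V) :
    (forestMaps V k).card * k.factorial * (Fintype.card V - k).factorial * Fintype.card V =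
      k * (Fintype.card V).factorial * Fintype.card V ^ (Fintype.card V - k) := by
  -- The recurrence is run downwards from the only forest with `n` roots, the identity.
  induction hkn using Nat.decreasingInduction with
  | self => rw [card_forestMaps_card]; simp; ring
  | of_succ k hkn ih =>
    have ih := ih (by omega)
    have hr := forestMaps_recurrence (V := V) k
    obtain ⟨d, hd⟩ := Nat.exists_eq_add_of_lt hkn
    generalize Fintype.card V = n at *
    have e1 : n - k = d + 1 := by omega
    have e2 : n - (k + 1) = d := by omega
    rw [e1] at hr ⊢
    rw [e2] at ih
    rw [Nat.factorial_succ, pow_succ]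
    rw [Nat.factorial_succ] at ih
    refine Nat.eq_of_mul_eq_mul_left k.succ_pos ?_
    generalize (forestMaps V k).card = A at *
    generalize (forestMaps V (k + 1)).card = B at *
    simp only [Nat.succ_eq_add_one]
    calc (k + 1) * (A * k.factorial * ((d + 1) * d.factorial) * n)
        = ((d + 1) * A) * ((k + 1) * k.factorial * d.factorial * n) := by ring
      _ = (n * k) * (B * ((k + 1) * k.factorial) * d.factorial * n) := by rw [← hr]; ring
      _ = _ := by rw [ih]; ring

end Forest

/-! ### From rooted forests to maps with one cycle -/

section Cycle

open scoped Classical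

lemma iterate_val_natCast {V : Type*} {f : V → V} {v : V} {l : ℕ} (hv : minimalPeriod f v = l)
    (m : ℕ) : f^[(m : ZMod l).val] v = f^[m] v := by
  rw [ZMod.val_natCast, ← hv, iterate_mod_minimalPeriod_eq]

lemma minimalPeriod_pos_of_reached {V : Type*} {f : V → V} {v : V}
    (h : ∀ w, ∃ m, f^[m] w = v) : 0 < minimalPeriod f v := by
  obtain ⟨m, hm⟩ := h (f v)
  exact IsPeriodicPt.minimalPeriod_pos m.succ_pos
    (by unfold IsPeriodicPt IsFixedPt; rwa [iterate_succ_apply])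

lemma minimalPeriod_eq_of_reached {V : Type*} {f : V → V} {v w : V}
    (hv : ∀ u, ∃ m, f^[m] u = v) (hw : ∀ u, ∃ m, f^[m] u = w) :
    minimalPeriod f v = minimalPeriod f w := by
  obtain ⟨m, rfl⟩ := hv w
  exact minimalPeriod_apply_iterate
    (minimalPeriod_pos_iff_mem_periodicPts.1 (minimalPeriod_pos_of_reached hw)) m

variable {V : Type*}

/-- Close up a labelled list of roots of a forest to a cycle. -/
noncomputable def closeCycle {l : ℕ} [NeZero l] (F : V → V) (e : ZMod l → V) (w : V) : V :=
  if F w = w then e (invFun e w + 1) else F w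

/-- Remove the cycle through `v`, making all its vertices roots. -/
noncomputable def openCycle (f : V → V) (v w : V) : V :=
  if ∃ i, f^[i] v = w then w else f w

lemma closeCycle_iterate {l : ℕ} [NeZero l] {F : V → V} {e : ZMod l → V} (he : Injective e)
    (hF : ∀ v, F v = v ↔ ∃ i, e i = v) (i : ZMod l) (m : ℕ) :
    (closeCycle F e)^[m] (e i) = e (i + m) := by
  induction m with
  | zero => simp
  | succ m ih =>
    rw [iterate_succ_apply', ih, closeCycle, if_pos ((hF _).2 ⟨_, rfl⟩), leftInverse_invFun he]
    push_cast
    rw [add_assoc]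

lemma closeCycle_reached {l : ℕ} [NeZero l] {F : V → V} {e : ZMod l → V} (he : Injective e)
    (hF : ∀ v, F v = v ↔ ∃ i, e i = v) (hf : IsForestMap F) (w : V) :
    ∃ m, (closeCycle F e)^[m] w = e 0 := by
  have h : ∃ m, IsFixedPt F (F^[m] w) := hf w
  have h1 : (closeCycle F e)^[Nat.find h] w = F^[Nat.find h] w :=
    iterate_eq_of_agree fun i hi => if_neg (Nat.find_min h hi)
  obtain ⟨i, hi⟩ := (hF _).1 (Nat.find_spec h).eq
  -- The orbit follows `F` to its first root `e i`; another `-i` steps modulo `l` around the cycle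
  -- lead to `e 0`.
  refine ⟨(-i).val + Nat.find h, ?_⟩
  rw [iterate_add_apply, h1, ← hi, closeCycle_iterate he hF]
  simp

lemma closeCycle_minimalPeriod {l : ℕ} [NeZero l] {F : V → V} {e : ZMod l → V}
    (he : Injective e) (hF : ∀ v, F v = v ↔ ∃ i, e i = v) :
    minimalPeriod (closeCycle F e) (e 0) = l := by
  have key : ∀ m, IsPeriodicPt (closeCycle F e) m (e 0) ↔ l ∣ m := by
    intro m
    unfold IsPeriodicPt IsFixedPt
    rw [closeCycle_iterate he hF, he.eq_iff, zero_add, ZMod.natCast_eq_zero_iff]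
  exact Nat.dvd_antisymm (((key l).2 dvd_rfl).minimalPeriod_dvd)
    ((key _).1 (isPeriodicPt_minimalPeriod _ _))

lemma openCycle_eq_self_iff {f : V → V} {v : V} (hv : ∀ w, ∃ m, f^[m] w = v) (w : V) :
    openCycle f v w = w ↔ ∃ i, f^[i] v = w := by
  unfold openCycle
  split_ifs with h
  · simp [h]
  · refine iff_of_false (fun hw => h ?_) h
    obtain ⟨m, hm⟩ := hv w
    exact ⟨0, by rw [← hm, iterate_fixed hw]; exact iterate_zero_apply ..⟩

lemma openCycle_isForestMap {f : V → V} {v : V} (hv : ∀ w, ∃ m, f^[m] w = v) :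
    IsForestMap (openCycle f v) := by
  intro w
  have h : ∃ m i, f^[i] v = f^[m] w := by
    obtain ⟨m, hm⟩ := hv w
    exact ⟨m, 0, hm.symm⟩
  have h1 : (openCycle f v)^[Nat.find h] w = f^[Nat.find h] w :=
    iterate_eq_of_agree fun i hi => if_neg (Nat.find_min h hi)
  -- The two maps agree along the orbit until it first meets the cycle, whose vertices are now
  -- roots.
  refine ⟨Nat.find h, ?_⟩
  rw [h1]
  exact (openCycle_eq_self_iff hv _).2 (Nat.find_spec h)

lemma exists_iterate_iff_zmod {f : V → V} {v : V} {l : ℕ} [NeZero l] (hl : minimalPeriod f v = l)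
    (w : V) : (∃ i, f^[i] v = w) ↔ ∃ i : ZMod l, f^[i.val] v = w :=
  ⟨fun ⟨i, hi⟩ => ⟨i, by rw [iterate_val_natCast hl, hi]⟩, fun ⟨i, hi⟩ => ⟨_, hi⟩⟩

lemma iterate_val_injective {f : V → V} {v : V} {l : ℕ} [NeZero l] (hl : minimalPeriod f v = l) :
    Injective fun i : ZMod l => f^[i.val] v := by
  intro i j h
  have hi : i.val < minimalPeriod f v := by rw [hl]; exact ZMod.val_lt i
  have hj : j.val < minimalPeriod f v := by rw [hl]; exact ZMod.val_lt j
  exact ZMod.val_injective l ((iterate_eq_iterate_iff_of_lt_minimalPeriod hi hj).1 h)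

variable (V) [Fintype V]

/-- Maps with connected functional graph whose unique cycle has length `l`. -/
noncomputable def cycleMaps (l : ℕ) : Finset (V → V) :=
  {f | ∃ v, (∀ w, ∃ m, f^[m] w = v) ∧ minimalPeriod f v = l}

variable {V}

lemma card_cycle_vertices {f : V → V} {l : ℕ} (hf : f ∈ cycleMaps V l) :
    (Finset.univ.filter fun v => (∀ w, ∃ m, f^[m] w = v) ∧ minimalPeriod f v = l).card = l := by
  simp only [cycleMaps, Finset.mem_filter, Finset.mem_univ, true_and] at hf
  obtain ⟨v, hv, hl⟩ := hf
  have hpos := minimalPeriod_pos_of_reached hv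
  have : (Finset.univ.filter fun v => (∀ w, ∃ m, f^[m] w = v) ∧ minimalPeriod f v = l) =
      (Finset.range l).image fun i => f^[i] v := by
    ext u
    simp only [Finset.mem_filter, Finset.mem_univ, true_and, Finset.mem_image, Finset.mem_range]
    constructor
    · rintro ⟨hu, -⟩
      obtain ⟨m, rfl⟩ := hu v
      exact ⟨m % l, Nat.mod_lt _ (hl ▸ hpos), by rw [← hl, iterate_mod_minimalPeriod_eq]⟩
    · rintro ⟨i, -, rfl⟩
      refine ⟨fun w => ?_, ?_⟩
      · obtain ⟨m, hm⟩ := hv w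
        exact ⟨i + m, by rw [iterate_add_apply, hm]⟩
      · rw [minimalPeriod_apply_iterate (minimalPeriod_pos_iff_mem_periodicPts.1 hpos), hl]
  rw [this, Finset.card_image_of_injOn, Finset.card_range]
  intro i hi j hj h
  simp only [Finset.coe_range, Set.mem_Iio] at hi hj
  exact (iterate_eq_iterate_iff_of_lt_minimalPeriod (hl ▸ hi) (hl ▸ hj)).1 h

lemma card_root_labellings {F : V → V} {l : ℕ} [NeZero l] (hF : F ∈ forestMaps V l) :
    (Finset.univ.filter fun e : ZMod l → V =>
      Injective e ∧ ∀ v, F v = v ↔ ∃ i, e i = v).card = l.factorial := by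
  simp only [forestMaps, Finset.mem_filter, Finset.mem_univ, true_and] at hF
  have hc : Fintype.card (ZMod l) = Fintype.card {v // F v = v} := by
    rw [ZMod.card, Fintype.card_subtype, hF.2]
  rw [← Fintype.card_subtype]
  let E : {e : ZMod l → V // Injective e ∧ ∀ v, F v = v ↔ ∃ i, e i = v} ≃
      (ZMod l ≃ {v // F v = v}) :=
    { toFun := fun e => Equiv.ofBijective (fun i => ⟨e.1 i, (e.2.2 _).2 ⟨i, rfl⟩⟩)
        ⟨fun i j h => e.2.1 (Subtype.ext_iff.1 h), fun v => by
          obtain ⟨i, hi⟩ := (e.2.2 v.1).1 v.2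
          exact ⟨i, Subtype.ext hi⟩⟩
      invFun := fun σ => ⟨fun i => σ i, fun i j h => σ.injective (Subtype.ext h), fun v =>
        ⟨fun h => ⟨σ.symm ⟨v, h⟩, by simp⟩, by rintro ⟨i, rfl⟩; exact (σ i).2⟩⟩
      left_inv := fun e => rfl
      right_inv := fun σ => by ext i; rfl }
  rw [Fintype.card_congr E, Fintype.card_equiv (Fintype.equivOfCardEq hc), ZMod.card]

lemma card_openCycle_fixed {f : V → V} {v : V} {l : ℕ} [NeZero l]
    (hv : ∀ w, ∃ m, f^[m] w = v) (hl : minimalPeriod f v = l) :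
    (Finset.univ.filter fun w => openCycle f v w = w).card = l := by
  rw [← ZMod.card l, ← Finset.card_univ,
    ← Finset.card_image_of_injective Finset.univ (iterate_val_injective hl)]
  congr 1
  ext w
  simp [openCycle_eq_self_iff hv, exists_iterate_iff_zmod hl]

/-- Both sides count the same objects: a map with a base vertex on its `l`-cycle, or a forest whose
`l` roots are listed in order by `ZMod l`. The base vertex is the root with label 0. -/
lemma mul_card_cycleMaps (l : ℕ) [NeZero l] :
    l * (cycleMaps V l).card = l.factorial * (forestMaps V l).card := by
  have h1 : ((cycleMaps V l).sigma fun f => Finset.univ.filter fun v =>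
      (∀ w, ∃ m, f^[m] w = v) ∧ minimalPeriod f v = l).card = l * (cycleMaps V l).card := by
    rw [Finset.card_sigma, Finset.sum_const_nat (m := l) fun f hf => card_cycle_vertices hf,
      mul_comm]
  have h2 : ((forestMaps V l).sigma fun F => Finset.univ.filter fun e : ZMod l → V =>
      Injective e ∧ ∀ v, F v = v ↔ ∃ i, e i = v).card = l.factorial * (forestMaps V l).card := by
    rw [Finset.card_sigma, Finset.sum_const_nat fun f hf => card_root_labellings hf,
      mul_comm]
  rw [← h1, ← h2]
  refine Finset.card_bij' (fun p _ => ⟨openCycle p.1 p.2, fun i => p.1^[i.val] p.2⟩)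
    (fun q _ => ⟨closeCycle q.1 q.2, q.2 0⟩) ?_ ?_ ?_ ?_
  · rintro ⟨f, v⟩ hp
    simp only [Finset.mem_sigma, Finset.mem_filter, Finset.mem_univ, true_and] at hp ⊢
    obtain ⟨-, hv, hl⟩ := hp
    refine ⟨?_, iterate_val_injective hl, fun w => ?_⟩
    · simp only [forestMaps, Finset.mem_filter, Finset.mem_univ, true_and]
      exact ⟨openCycle_isForestMap hv, card_openCycle_fixed hv hl⟩
    · rw [openCycle_eq_self_iff hv, exists_iterate_iff_zmod hl]
  · rintro ⟨F, e⟩ hq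
    simp only [Finset.mem_sigma, Finset.mem_filter, Finset.mem_univ, true_and] at hq ⊢
    obtain ⟨hF, he, hfix⟩ := hq
    simp only [forestMaps, Finset.mem_filter, Finset.mem_univ, true_and] at hF
    have h3 : (∀ w, ∃ m, (closeCycle F e)^[m] w = e 0) ∧
        minimalPeriod (closeCycle F e) (e 0) = l :=
      ⟨closeCycle_reached he hfix hF.1, closeCycle_minimalPeriod he hfix⟩
    exact ⟨by simpa only [cycleMaps, Finset.mem_filter, Finset.mem_univ, true_and] using ⟨_, h3⟩,
      h3⟩
  · rintro ⟨f, v⟩ hp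
    simp only [Finset.mem_sigma, Finset.mem_filter, Finset.mem_univ, true_and] at hp
    obtain ⟨-, hv, hl⟩ := hp
    simp only [ZMod.val_zero, iterate_zero, id_eq]
    congr 1
    funext w
    unfold closeCycle
    split_ifs with h
    · rw [openCycle_eq_self_iff hv, exists_iterate_iff_zmod hl] at h
      obtain ⟨i, rfl⟩ := h
      have := leftInverse_invFun (iterate_val_injective hl) i
      rw [this, ← iterate_succ_apply' f, ← iterate_val_natCast hl (_ + 1)]
      simp
    · rw [openCycle_eq_self_iff hv] at h
      exact if_neg h
  · rintro ⟨F, e⟩ hq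
    simp only [Finset.mem_sigma, Finset.mem_filter, Finset.mem_univ, true_and] at hq
    obtain ⟨-, he, hfix⟩ := hq
    have h3 : (fun i : ZMod l => (closeCycle F e)^[i.val] (e 0)) = e := by
      funext i
      rw [closeCycle_iterate he hfix]
      simp
    have h4 : openCycle (closeCycle F e) (e 0) = F := by
      funext w
      unfold openCycle
      split_ifs with h
      · obtain ⟨i, rfl⟩ := h
        rw [closeCycle_iterate he hfix]
        exact ((hfix _).2 ⟨_, rfl⟩).symm
      · refine if_neg fun hw => h ?_
        obtain ⟨i, rfl⟩ := (hfix w).1 hw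
        exact ⟨i.val, by rw [closeCycle_iterate he hfix]; simp⟩
    simp only [h3, h4]

/-- The number of connected functional graphs on `n` labeled vertices with a cycle of length `l`
is `n! / (n - l)! * n ^ (n - l - 1)`. -/
lemma card_cycleMaps {l : ℕ} (hl : 1 ≤ l) (hln : l ≤ Fintype.card V) :
    (cycleMaps V l).card * (Fintype.card V - l).factorial * Fintype.card V =
      (Fintype.card V).factorial * Fintype.card V ^ (Fintype.card V - l) := by
  have : NeZero l := ⟨by omega⟩
  refine Nat.eq_of_mul_eq_mul_left hl ?_
  rw [← mul_assoc l _ (_ ^ _), ← card_forestMaps hl hln, ← mul_assoc, ← mul_assoc,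
    mul_card_cycleMaps]
  ring

end Cycle

/-! ### The two orientations of a unicyclic graph -/

section Orientation

lemma SimpleGraph.Connected.exists_adj_dist_lt {V : Type*} {G : SimpleGraph V} (hG : G.Connected)
    {v x : V} (h : v ≠ x) : ∃ w, G.Adj v w ∧ G.dist w x < G.dist v x := by
  obtain ⟨p, hp⟩ := hG.exists_walk_length_eq_dist v x
  cases p with
  | nil => exact absurd rfl h
  | cons hadj q =>
    refine ⟨_, hadj, ?_⟩
    have := G.dist_le q
    rw [SimpleGraph.Walk.length_cons] at hp
    omega

variable {V : Type*}

/-- The undirected graph underlying the functional graph of `f`. -/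
def functionalGraph (f : V → V) : SimpleGraph V := SimpleGraph.fromRel fun a b => f a = b

/-- `f` matches every vertex `v` bijectively to an incident edge `{v, f v}`. -/
def IsEdgeMatching (G : SimpleGraph V) (f : V → V) : Prop :=
  (∀ v, G.Adj v (f v)) ∧ Injective fun v => s(v, f v)

/-- Otherwise `v` and `f v` would be matched to the same edge. -/
lemma IsEdgeMatching.apply_apply_ne {G : SimpleGraph V} {f : V → V} (h : IsEdgeMatching G f)
    (v : V) : f (f v) ≠ v := by
  intro hv
  refine (h.1 v).ne (h.2 ?_)
  simp only [hv]
  exact Sym2.eq_swap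

lemma IsEdgeMatching.edgeSet_eq_range [Finite V] {G : SimpleGraph V} {f : V → V}
    (h : IsEdgeMatching G f) (hG : G.edgeSet.ncard = Nat.card V) :
    Set.range (fun v => s(v, f v)) = G.edgeSet := by
  refine Set.eq_of_subset_of_ncard_le ?_ ?_
  · rintro _ ⟨v, rfl⟩
    exact h.1 v
  · rw [hG, Set.ncard_range_of_injective h.2]

lemma functionalGraph_adj {f : V → V} {a b : V} :
    (functionalGraph f).Adj a b ↔ a ≠ b ∧ (f a = b ∨ f b = a) := by
  simp [functionalGraph]

lemma IsEdgeMatching.functionalGraph_eq [Finite V] {G : SimpleGraph V} {f : V → V}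
    (h : IsEdgeMatching G f) (hG : G.edgeSet.ncard = Nat.card V) : functionalGraph f = G := by
  ext a b
  rw [functionalGraph_adj, ← G.mem_edgeSet, ← h.edgeSet_eq_range hG]
  simp only [Set.mem_range, Sym2.eq_iff]
  constructor
  · rintro ⟨-, rfl | rfl⟩
    · exact ⟨a, .inl ⟨rfl, rfl⟩⟩
    · exact ⟨b, .inr ⟨rfl, rfl⟩⟩
  · rintro ⟨v, ⟨rfl, rfl⟩ | ⟨rfl, rfl⟩⟩
    · exact ⟨(h.1 _).ne, .inl rfl⟩
    · exact ⟨(h.1 _).ne.symm, .inr rfl⟩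

lemma functionalGraph_isEdgeMatching {f : V → V} (hf : ∀ v, f (f v) ≠ v) :
    IsEdgeMatching (functionalGraph f) f := by
  refine ⟨fun v => functionalGraph_adj.2 ⟨fun h => hf v ?_, .inl rfl⟩, fun v w h => ?_⟩
  · rw [← h, ← h]
  · simp only [Sym2.eq_iff] at h
    rcases h with ⟨h, -⟩ | ⟨h1, h2⟩
    · exact h
    · exact absurd (by rw [h2, ← h1]) (hf v)

lemma exists_edge_not_isBridge [Finite V] {G : SimpleGraph V} (hG : G.Connected)
    (hc : G.edgeSet.ncard = Nat.card V) : ∃ a b, G.Adj a b ∧ ¬ G.IsBridge s(a, b) := by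
  by_contra! h
  have := Fintype.ofFinite V
  classical
  have ht : G.IsTree := ⟨hG, SimpleGraph.isAcyclic_iff_forall_adj_isBridge.2 h⟩
  have := ht.card_edgeFinset
  rw [Set.ncard_eq_toFinset_card', Nat.card_eq_fintype_card] at hc
  rw [SimpleGraph.edgeFinset, hc] at this
  omega

/-- An edge matching is determined by the vertex matched to a non-bridge edge: all other vertices
are matched along a shortest path to that vertex. -/
lemma IsEdgeMatching.eq_update [Finite V] [DecidableEq V] {G T : SimpleGraph V} {f p : V → V}
    {x y : V} (h : IsEdgeMatching G f) (hG : G.edgeSet.ncard = Nat.card V) (hT : T ≤ G)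
    (hxy : ¬ T.Adj x y) (hp : ∀ v, v ≠ x → T.Adj v (p v) ∧ T.dist (p v) x < T.dist v x)
    (hfx : f x = y) : f = update p x y := by
  have key : ∀ d v, v ≠ x → T.dist v x = d → f v = p v := by
    intro d
    induction d using Nat.strong_induction_on with
    | h d ih =>
      rintro v hv rfl
      obtain ⟨hadj, hlt⟩ := hp v hv
      have hm : s(v, p v) ∈ Set.range fun u => s(u, f u) := by
        rw [h.edgeSet_eq_range hG]
        exact hT hadj
      obtain ⟨u, hu⟩ := hm
      simp only [Sym2.eq_iff] at hu
      -- The edge `{v, p v}` is matched to `v`, as wanted, or to `p v`. In the latter case `f (p v)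
      -- = v`. If `p v = x`, this forces `v = y`, although `T` omits the edge `{x, y}`; otherwise
      -- induction says that `f (p v)` is nearer to `x` than `p v`, whereas `v` is farther.
      rcases hu with ⟨rfl, h2⟩ | ⟨rfl, h2⟩
      · exact h2
      · by_cases hx : p v = x
        · rw [hx, hfx] at h2
          rw [hx, ← h2] at hadj
          exact absurd hadj.symm hxy
        · have h3 := ih _ hlt _ hx rfl
          have h4 := (hp _ hx).2
          rw [← h3, h2] at h4
          omega
  funext v
  by_cases hv : v = x
  · subst hv; simpa using hfx
  · rw [update_of_ne hv]
    exact key _ v hv rfl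

lemma isEdgeMatching_update [DecidableEq V] {G T : SimpleGraph V} {p : V → V}
    {x y : V} (hT : T ≤ G) (hxy : ¬ T.Adj x y) (hG : G.Adj x y)
    (hp : ∀ v, v ≠ x → T.Adj v (p v) ∧ T.dist (p v) x < T.dist v x) :
    IsEdgeMatching G (update p x y) := by
  constructor
  · intro v
    by_cases hv : v = x
    · subst hv; simpa using hG
    · rw [update_of_ne hv]
      exact hT (hp v hv).1
  · have key : ∀ v, v ≠ x → s(v, p v) ≠ s(x, y) := by
      intro v hv h
      have := (hp v hv).1
      rw [← T.mem_edgeSet, h, T.mem_edgeSet] at this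
      exact hxy this
    intro v w h
    by_cases hv : v = x <;> by_cases hw : w = x
    · rw [hv, hw]
    · subst hv
      simp only [update_self, update_of_ne hw] at h
      exact absurd h.symm (key w hw)
    · subst hw
      simp only [update_self, update_of_ne hv] at h
      exact absurd h (key v hv)
    · simp only [update_of_ne hv, update_of_ne hw, Sym2.eq_iff] at h
      rcases h with ⟨h, -⟩ | ⟨h1, h2⟩
      · exact h
      -- Here `v` and `w` would be each other's parents, so each would be nearer to `x` than the
      -- other.
      · have h3 := (hp v hv).2
        have h4 := (hp w hw).2
        rw [h2] at h3
        rw [← h1] at h4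
        omega

open scoped Classical in
-- Since `G` is not a tree, some edge `{a, b}` is not a bridge, and deleting it keeps the graph
-- connected. A matching gives this edge to `a` or to `b`, and either choice extends in exactly one
-- way.
lemma card_edgeMatchings [Fintype V] {G : SimpleGraph V} (hG : G.Connected)
    (hc : G.edgeSet.ncard = Nat.card V) :
    (Finset.univ.filter fun f : V → V => IsEdgeMatching G f).card = 2 := by
  obtain ⟨a, b, hab, hbr⟩ := exists_edge_not_isBridge hG hc
  have hT := hG.connected_delete_edge_of_not_isBridge hbr
  have hle : G.deleteEdges {s(a, b)} ≤ G := G.deleteEdges_le _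
  have hnab : ¬ (G.deleteEdges {s(a, b)}).Adj a b := by simp
  have hnba : ¬ (G.deleteEdges {s(a, b)}).Adj b a := fun h => hnab h.symm
  generalize G.deleteEdges {s(a, b)} = T at *
  have hex : ∀ x v, ∃ w, v ≠ x → T.Adj v w ∧ T.dist w x < T.dist v x := by
    intro x v
    by_cases h : v = x
    · exact ⟨v, fun h' => absurd h h'⟩
    · obtain ⟨w, hw⟩ := hT.exists_adj_dist_lt h
      exact ⟨w, fun _ => hw⟩
  choose p hp using hex
  rw [Finset.card_eq_two]
  have ha := isEdgeMatching_update hle hnab hab (hp a)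
  have hb := isEdgeMatching_update hle hnba hab.symm (hp b)
  refine ⟨update (p a) a b, update (p b) b a, fun h => ?_, ?_⟩
  · have h1 := congrFun h a
    have h2 := hb.apply_apply_ne b
    rw [update_self, ← h1, update_self] at h2
    exact h2 rfl
  · ext f
    simp only [Finset.mem_filter, Finset.mem_univ, true_and, Finset.mem_insert,
      Finset.mem_singleton]
    constructor
    · intro hf
      have hm : s(a, b) ∈ Set.range fun u => s(u, f u) := by
        rw [hf.edgeSet_eq_range hc]
        exact hab
      obtain ⟨u, hu⟩ := hm
      simp only [Sym2.eq_iff] at hu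
      rcases hu with ⟨rfl, h2⟩ | ⟨rfl, h2⟩
      · exact .inl (hf.eq_update hc hle hnab (hp _) h2)
      · exact .inr (hf.eq_update hc hle hnba (hp _) h2)
    · rintro (rfl | rfl)
      · exact ha
      · exact hb

end Orientation

/-! ### Unicyclic graphs as functional graphs -/

section Unicyclic

open scoped Classical

variable (V : Type*) [Fintype V]

/-- Connected simple graphs with as many edges as vertices. -/
noncomputable def unicyclicGraphs : Finset (SimpleGraph V) :=
  {G | G.Connected ∧ G.edgeSet.ncard = Nat.card V}

/-- Maps with connected functional graph whose unique cycle has length at least `3`. -/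
noncomputable def longCycleMaps : Finset (V → V) :=
  (Finset.Icc 3 (Fintype.card V)).biUnion (cycleMaps V)

variable {V}

lemma mem_cycleMaps {f : V → V} {l : ℕ} :
    f ∈ cycleMaps V l ↔ ∃ v, (∀ w, ∃ m, f^[m] w = v) ∧ minimalPeriod f v = l := by
  simp [cycleMaps]

lemma mem_longCycleMaps {f : V → V} :
    f ∈ longCycleMaps V ↔ ∃ v, (∀ w, ∃ m, f^[m] w = v) ∧ 3 ≤ minimalPeriod f v := by
  simp only [longCycleMaps, Finset.mem_biUnion, Finset.mem_Icc]
  constructor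
  · rintro ⟨l, hl, hf⟩
    obtain ⟨v, hv, rfl⟩ := mem_cycleMaps.1 hf
    exact ⟨v, hv, hl.1⟩
  · rintro ⟨v, hv, h3⟩
    have hf : f ∈ cycleMaps V (minimalPeriod f v) := mem_cycleMaps.2 ⟨v, hv, rfl⟩
    refine ⟨_, ⟨h3, ?_⟩, hf⟩
    conv_lhs => rw [← card_cycle_vertices hf]
    exact Finset.card_le_univ _

lemma apply_apply_ne_of_mem_longCycleMaps {f : V → V} (hf : f ∈ longCycleMaps V) (w : V) :
    f (f w) ≠ w := by
  intro hw
  obtain ⟨v, hv, h3⟩ := mem_longCycleMaps.1 hf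
  obtain ⟨m, rfl⟩ := hv w
  have : IsPeriodicPt f 2 (f^[m] w) := IsPeriodicPt.apply_iterate (n := 2) hw m
  have := this.minimalPeriod_le two_pos
  omega

lemma functionalGraph_connected {f : V → V} (hf : f ∈ longCycleMaps V) :
    (functionalGraph f).Connected := by
  obtain ⟨v, hv, -⟩ := mem_longCycleMaps.1 hf
  have hM := functionalGraph_isEdgeMatching (apply_apply_ne_of_mem_longCycleMaps hf)
  refine (SimpleGraph.connected_iff_exists_forall_reachable _).2 ⟨v, fun w => ?_⟩
  have : ∀ m, (functionalGraph f).Reachable w (f^[m] w) := by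
    intro m
    induction m with
    | zero => rfl
    | succ m ih =>
      rw [iterate_succ_apply']
      exact ih.trans (hM.1 _).reachable
  obtain ⟨m, rfl⟩ := hv w
  exact (this m).symm

lemma functionalGraph_mem_unicyclicGraphs {f : V → V} (hf : f ∈ longCycleMaps V) :
    functionalGraph f ∈ unicyclicGraphs V := by
  have hM := functionalGraph_isEdgeMatching (apply_apply_ne_of_mem_longCycleMaps hf)
  simp only [unicyclicGraphs, Finset.mem_filter, Finset.mem_univ, true_and]
  refine ⟨functionalGraph_connected hf, ?_⟩
  rw [← Set.ncard_range_of_injective hM.2]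
  congr 1
  ext e
  induction e with
  | h a b =>
    rw [SimpleGraph.mem_edgeSet, functionalGraph_adj]
    simp only [Set.mem_range, Sym2.eq_iff]
    constructor
    · rintro ⟨-, rfl | rfl⟩
      · exact ⟨a, .inl ⟨rfl, rfl⟩⟩
      · exact ⟨b, .inr ⟨rfl, rfl⟩⟩
    · rintro ⟨v, ⟨rfl, rfl⟩ | ⟨rfl, rfl⟩⟩
      · exact ⟨(hM.1 _).ne, .inl rfl⟩
      · exact ⟨(hM.1 _).ne.symm, .inr rfl⟩

/-- Orbits of adjacent vertices merge, so by connectedness any two orbits meet and there is only one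
cycle. Period 1 would be a loop, and period 2 an edge matched twice. -/
lemma IsEdgeMatching.mem_longCycleMaps {G : SimpleGraph V} (hG : G.Connected) {f : V → V}
    (hM : IsEdgeMatching G f) (hc : G.edgeSet.ncard = Nat.card V) : f ∈ longCycleMaps V := by
  have hmeet : ∀ a b, ∃ i j, f^[i] a = f^[j] b := by
    intro a b
    obtain ⟨p⟩ := hG.preconnected a b
    induction p with
    | nil => exact ⟨0, 0, rfl⟩
    | cons h q ih =>
      rw [← hM.functionalGraph_eq hc, functionalGraph_adj] at h
      obtain ⟨i, j, hij⟩ := ih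
      rcases h.2 with rfl | rfl
      · exact ⟨i + 1, j, by rw [iterate_succ_apply, hij]⟩
      · exact ⟨i, j + 1, by
          rw [iterate_succ_apply', ← hij, ← iterate_succ_apply' f, iterate_succ_apply]⟩
  obtain ⟨u⟩ := hG.nonempty
  obtain ⟨i, j, hij, hlt⟩ : ∃ i j, f^[i] u = f^[j] u ∧ i < j := by
    obtain ⟨i, j, hne, h⟩ := Finite.exists_ne_map_eq_of_infinite fun i : ℕ => f^[i] u
    rcases lt_or_gt_of_ne hne with hl | hl
    · exact ⟨i, j, h, hl⟩
    · exact ⟨j, i, h.symm, hl⟩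
  have hper : IsPeriodicPt f (j - i) (f^[i] u) := by
    unfold IsPeriodicPt IsFixedPt
    rw [← iterate_add_apply, Nat.sub_add_cancel hlt.le, hij]
  generalize f^[i] u = v at hper
  have hmem : v ∈ periodicPts f := mk_mem_periodicPts (by omega) hper
  refine _root_.mem_longCycleMaps.2 ⟨v, fun w => ?_, ?_⟩
  · obtain ⟨a, b, hab⟩ := hmeet w v
    have hpos := minimalPeriod_pos_of_mem_periodicPts hmem
    -- After `a` steps `w` is where `v` is after `b` steps; the rest completes `b` full turns from
    -- `v`.
    refine ⟨(minimalPeriod f v * b - b) + a, ?_⟩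
    rw [iterate_add_apply, hab, ← iterate_add_apply,
      Nat.sub_add_cancel (Nat.le_mul_of_pos_left b hpos)]
    exact ((isPeriodicPt_minimalPeriod f v).mul_const b).eq
  · have hpos := minimalPeriod_pos_of_mem_periodicPts hmem
    have h1 := isPeriodicPt_minimalPeriod f v
    by_contra! hlt3
    interval_cases hl : minimalPeriod f v
    · exact (hM.1 v).ne h1.eq.symm
    · exact hM.apply_apply_ne v h1.eq

/-- Each connected unicyclic graph underlies exactly two functional graphs. -/
lemma sum_longCycleMaps (φ : SimpleGraph V → ℕ) :
    ∑ f ∈ longCycleMaps V, φ (functionalGraph f) = 2 * ∑ G ∈ unicyclicGraphs V, φ G := by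
  rw [← Finset.sum_fiberwise_of_maps_to (fun f hf => functionalGraph_mem_unicyclicGraphs hf),
    Finset.mul_sum]
  refine Finset.sum_congr rfl fun G hG => ?_
  simp only [unicyclicGraphs, Finset.mem_filter, Finset.mem_univ, true_and] at hG
  rw [Finset.sum_congr rfl (g := fun _ => φ G) fun f hf => by rw [(Finset.mem_filter.1 hf).2],
    Finset.sum_const, smul_eq_mul, ← card_edgeMatchings hG.1 hG.2]
  congr 2
  -- The fibre over `G` is exactly its set of edge matchings.
  ext f
  simp only [Finset.mem_filter, Finset.mem_univ, true_and]
  constructor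
  · rintro ⟨hf, rfl⟩
    exact functionalGraph_isEdgeMatching (apply_apply_ne_of_mem_longCycleMaps hf)
  · intro hf
    exact ⟨hf.mem_longCycleMaps hG.1 hG.2, hf.functionalGraph_eq hG.2⟩

lemma sum_longCycleMaps_eq (ψ : (V → V) → ℕ) :
    ∑ f ∈ longCycleMaps V, ψ f =
      ∑ l ∈ Finset.Icc 3 (Fintype.card V), ∑ f ∈ cycleMaps V l, ψ f := by
  refine Finset.sum_biUnion ?_
  intro i _ j _ hij
  refine Finset.disjoint_left.2 fun f hi hj => hij ?_
  obtain ⟨v, hv, rfl⟩ := mem_cycleMaps.1 hi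
  obtain ⟨w, hw, rfl⟩ := mem_cycleMaps.1 hj
  exact minimalPeriod_eq_of_reached hv hw

lemma two_mul_card_unicyclicGraphs :
    2 * (unicyclicGraphs V).card = ∑ l ∈ Finset.Icc 3 (Fintype.card V), (cycleMaps V l).card := by
  have := sum_longCycleMaps (V := V) fun _ => 1
  rw [Finset.sum_const, smul_eq_mul, mul_one] at this
  rw [← Finset.card_eq_sum_ones] at this
  rw [← this, Finset.card_eq_sum_ones, sum_longCycleMaps_eq]
  exact Finset.sum_congr rfl fun l _ => (Finset.card_eq_sum_ones _).symm

end Unicyclic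

/-! ### Ordered bipartitions and the parity of the cycle -/

section Colouring

open scoped Classical

variable {V : Type*} [Fintype V]

/-- The two-colourings of a graph, given by their first colour class. -/
noncomputable def colourClasses (G : SimpleGraph V) : Finset (Finset V) :=
  {A | ∀ a b, G.Adj a b → (a ∈ A ↔ b ∉ A)}

lemma mem_colourClasses_functionalGraph {f : V → V} (hf : f ∈ longCycleMaps V) {A : Finset V} :
    A ∈ colourClasses (functionalGraph f) ↔ ∀ v, f v ∈ A ↔ v ∉ A := by
  simp only [colourClasses, Finset.mem_filter, Finset.mem_univ, true_and]
  constructor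
  · intro h v
    have := h v (f v)
      ((functionalGraph_isEdgeMatching (apply_apply_ne_of_mem_longCycleMaps hf)).1 v)
    tauto
  · intro h a b hab
    obtain ⟨-, rfl | rfl⟩ := functionalGraph_adj.1 hab
    · have := h a
      tauto
    · exact h b

lemma iterate_mem_iff {V : Type*} {f : V → V} {A : Finset V} (h : ∀ v, f v ∈ A ↔ v ∉ A) (m : ℕ)
    (v : V) : f^[m] v ∈ A ↔ (Even m ↔ v ∈ A) := by
  induction m with
  | zero => simp
  | succ m ih =>
    rw [iterate_succ_apply', h, ih, Nat.even_add_one]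
    tauto

lemma even_iff_of_iterate_eq {V : Type*} {f : V → V} {v w : V} (hl : Even (minimalPeriod f v))
    {i j : ℕ} (hi : f^[i] w = v) (hj : f^[j] w = v) : Even i ↔ Even j := by
  wlog hij : i ≤ j generalizing i j
  · exact (this hj hi (by omega)).symm
  obtain ⟨k, rfl⟩ := Nat.exists_eq_add_of_le hij
  rw [add_comm, iterate_add_apply, hi] at hj
  have hk : Even k := hl.trans_dvd (IsPeriodicPt.minimalPeriod_dvd hj)
  rw [Nat.even_add]
  tauto

/-- Colours alternate along `f` and every orbit reaches `v`, so the colour of `v` determines all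
others. Going once around the cycle returns to `v` with its colour changed `l` times. -/
lemma card_colourClasses_functionalGraph {f : V → V} {l : ℕ}
    (hl : l ∈ Finset.Icc 3 (Fintype.card V))
    (hf : f ∈ cycleMaps V l) :
    (colourClasses (functionalGraph f)).card = if Even l then 2 else 0 := by
  have hP : f ∈ longCycleMaps V := Finset.mem_biUnion.2 ⟨l, hl, hf⟩
  obtain ⟨v, hv, rfl⟩ := mem_cycleMaps.1 hf
  split_ifs with he
  -- Arrival times at `v` differ by multiples of the even period, so their parity depends only on
  -- `w`.
  · let A : Finset V := {w | ∃ m, Even m ∧ f^[m] w = v}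
    have hA : ∀ {w m}, f^[m] w = v → (w ∈ A ↔ Even m) := by
      intro w m hm
      simp only [A, Finset.mem_filter, Finset.mem_univ, true_and]
      exact ⟨fun ⟨i, hi, hiv⟩ => (even_iff_of_iterate_eq he hiv hm).1 hi, fun h => ⟨m, h, hm⟩⟩
    have hA1 : ∀ w, f w ∈ A ↔ w ∉ A := by
      intro w
      obtain ⟨m, hm⟩ := hv (f w)
      rw [hA hm, hA (m := m + 1) (by rwa [iterate_succ_apply]), Nat.even_add_one, not_not]
    rw [Finset.card_eq_two]
    refine ⟨A, Aᶜ, fun h => ?_, ?_⟩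
    · have : v ∈ A ↔ v ∈ Aᶜ := by rw [← h]
      rw [Finset.mem_compl] at this
      tauto
    · ext B
      rw [mem_colourClasses_functionalGraph hP]
      simp only [Finset.mem_insert, Finset.mem_singleton]
      constructor
      · intro hB
        by_cases hvB : v ∈ B
        · left
          ext w
          obtain ⟨m, hm⟩ := hv w
          have := iterate_mem_iff hB m w
          rw [hm] at this
          rw [hA hm]
          tauto
        · right
          ext w
          obtain ⟨m, hm⟩ := hv w
          have := iterate_mem_iff hB m w
          rw [hm] at this
          rw [Finset.mem_compl, hA hm]
          tauto
      · rintro (rfl | rfl)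
        · exact hA1
        · intro w
          simp only [Finset.mem_compl, hA1]
  · rw [Finset.card_eq_zero, Finset.eq_empty_iff_forall_notMem]
    intro B hB
    rw [mem_colourClasses_functionalGraph hP] at hB
    have := iterate_mem_iff hB (minimalPeriod f v) v
    rw [iterate_minimalPeriod] at this
    tauto

lemma sum_card_colourClasses :
    ∑ G ∈ unicyclicGraphs V, (colourClasses G).card =
      ∑ l ∈ (Finset.Icc 3 (Fintype.card V)).filter Even, (cycleMaps V l).card := by
  have h := sum_longCycleMaps (V := V) fun G => (colourClasses G).card
  rw [sum_longCycleMaps_eq, Finset.sum_congr rfl fun l hl => Finset.sum_congr rfl fun f hf =>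
    card_colourClasses_functionalGraph hl hf] at h
  refine Nat.eq_of_mul_eq_mul_left two_pos (h.symm.trans ?_)
  rw [Finset.sum_filter, Finset.mul_sum]
  refine Finset.sum_congr rfl fun l _ => ?_
  split_ifs <;> simp [mul_comm]

lemma exists_equiv_sum (A : Finset V) {r s : ℕ} (hr : A.card = r) (hs : r + s = Fintype.card V) :
    ∃ e : V ≃ Fin r ⊕ Fin s, ∀ v, (e v).isLeft ↔ v ∈ A := by
  have e1 : {v // v ∈ A} ≃ Fin r := Fintype.equivFinOfCardEq (by simpa using hr)
  have e2 : {v // v ∉ A} ≃ Fin s := Fintype.equivFinOfCardEq (by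
    rw [Fintype.card_subtype_compl, Fintype.card_coe]; omega)
  refine ⟨(Equiv.sumCompl (· ∈ A)).symm.trans (Equiv.sumCongr e1 e2), fun v => ?_⟩
  by_cases h : v ∈ A <;> simp [h]

/-- Under a bijection of `V` with `Fin r ⊕ Fin s` taking `A` to the left part, lying below the
complete bipartite graph means having `A` as first colour class. -/
lemma numConnectedBipartiteParts_eq_card (A : Finset V) {r s : ℕ} (hr : A.card = r)
    (hs : r + s = Fintype.card V) :
    numConnectedBipartiteParts r s 1 =
      ((unicyclicGraphs V).filter fun G => A ∈ colourClasses G).card := by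
  obtain ⟨e, he⟩ := exists_equiv_sum A hr hs
  have hmem : ∀ G : SimpleGraph V, G ∈ (unicyclicGraphs V).filter (fun G => A ∈ colourClasses G) ↔
      (e.simpleGraph G ≤ completeBipartiteGraph (Fin r) (Fin s) ∧ (e.simpleGraph G).Connected ∧
        (e.simpleGraph G).edgeSet.ncard + 1 = r + s + 1) := by
    intro G
    have hiso : e.simpleGraph G ≃g G := SimpleGraph.Iso.comap e.symm G
    have hcard : (e.simpleGraph G).edgeSet.ncard = G.edgeSet.ncard :=
      Nat.card_congr hiso.mapEdgeSet
    simp only [unicyclicGraphs, colourClasses, Finset.mem_filter, Finset.mem_univ, true_and]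
    rw [hiso.connected_iff, hcard, hs, Nat.card_eq_fintype_card, and_comm, add_left_inj]
    refine and_congr_left fun _ => ⟨fun h x y hxy => ?_, fun h a b hab => ?_⟩
    · have := h _ _ hxy
      rw [← he, ← he, e.apply_symm_apply, e.apply_symm_apply] at this
      rw [completeBipartiteGraph_adj]
      revert this
      rcases x with x | x <;> rcases y with y | y <;> simp
    · have : (completeBipartiteGraph (Fin r) (Fin s)).Adj (e a) (e b) :=
        h (by simpa using hab)
      rw [completeBipartiteGraph_adj] at this
      rw [← he, ← he]
      revert this
      rcases e a with x | x <;> rcases e b with y | y <;> simp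
  unfold numConnectedBipartiteParts
  rw [← Fintype.card_coe, ← Nat.card_eq_fintype_card]
  exact (Nat.card_congr (e.simpleGraph.subtypeEquiv hmem)).symm

/-- Double counting of pairs `(G, A)`; the binomial coefficient counts the sets `A` of size `r`. -/
lemma sum_card_colourClasses_eq_sum_numConnectedBipartiteParts :
    ∑ G ∈ unicyclicGraphs V, (colourClasses G).card =
      ∑ r ∈ Finset.range (Fintype.card V + 1), (Fintype.card V).choose r *
        numConnectedBipartiteParts r (Fintype.card V - r) 1 := by
  have h1 : ∑ G ∈ unicyclicGraphs V, (colourClasses G).card =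
      ∑ A : Finset V, ((unicyclicGraphs V).filter fun G => A ∈ colourClasses G).card := by
    have := Finset.sum_card_bipartiteAbove_eq_sum_card_bipartiteBelow
      (s := unicyclicGraphs V) (t := Finset.univ) fun G A => A ∈ colourClasses G
    simpa [Finset.bipartiteAbove, Finset.bipartiteBelow] using this
  have h2 : ∀ A ∈ (Finset.univ : Finset (Finset V)),
      ((unicyclicGraphs V).filter fun G => A ∈ colourClasses G).card =
        numConnectedBipartiteParts A.card (Fintype.card V - A.card) 1 := fun A _ =>
    (numConnectedBipartiteParts_eq_card A rfl (Nat.add_sub_of_le A.card_le_univ)).symm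
  rw [h1, Finset.sum_congr rfl h2, ← Finset.powerset_univ,
    Finset.sum_powerset_apply_card
      (fun r => numConnectedBipartiteParts r (Fintype.card V - r) 1), Finset.card_univ]
  rfl

lemma numConnectedBipartite_eq_sum (n : ℕ) :
    numConnectedBipartite n 1 =
      ∑ l ∈ (Finset.Icc 3 n).filter Even, (cycleMaps (Fin n) l).card := by
  have h := (sum_card_colourClasses (V := Fin n)).symm.trans
    sum_card_colourClasses_eq_sum_numConnectedBipartiteParts
  rw [Fintype.card_fin] at h
  unfold numConnectedBipartite
  rw [Finset.Nat.sum_antidiagonal_eq_sum_range_succ_mk]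
  convert! h.symm

lemma two_mul_numConnected (n : ℕ) :
    2 * numConnected n 1 = ∑ l ∈ Finset.Icc 3 n, (cycleMaps (Fin n) l).card := by
  have h := two_mul_card_unicyclicGraphs (V := Fin n)
  rw [Fintype.card_fin] at h
  rw [← h]
  congr 1
  unfold numConnected
  rw [← Fintype.card_coe, ← Nat.card_eq_fintype_card]
  refine Nat.card_congr (Equiv.subtypeEquivRight fun G => ?_)
  simp [unicyclicGraphs]

end Colouring

open Filter Topology MeasureTheory

/-! ### Asymptotics of the sum of falling ratios -/

section Ramanujan

/-- The ratio `n (n - 1) ⋯ (n - k + 1) / n ^ k`. -/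
noncomputable def fallingRatio (n k : ℕ) : ℝ := n.descFactorial k / (n : ℝ) ^ k

lemma fallingRatio_nonneg (n k : ℕ) : 0 ≤ fallingRatio n k := by
  unfold fallingRatio; positivity

lemma fallingRatio_zero (n : ℕ) : fallingRatio n 0 = 1 := by simp [fallingRatio]

lemma fallingRatio_succ (n k : ℕ) :
    fallingRatio n (k + 1) = ((n - k : ℕ) / n : ℝ) * fallingRatio n k := by
  simp only [fallingRatio, Nat.descFactorial_succ, pow_succ', Nat.cast_mul]
  rw [mul_div_mul_comm]

lemma fallingRatio_eq_zero {n k : ℕ} (h : n < k) : fallingRatio n k = 0 := by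
  simp [fallingRatio, Nat.descFactorial_eq_zero_iff_lt.2 h]

lemma fallingRatio_antitone (n : ℕ) : Antitone (fallingRatio n) := by
  refine antitone_nat_of_succ_le fun k => ?_
  rw [fallingRatio_succ]
  refine mul_le_of_le_one_left (fallingRatio_nonneg n k) (div_le_one_of_le₀ ?_ (by positivity))
  exact_mod_cast Nat.sub_le n k

lemma fallingRatio_le_one (n k : ℕ) : fallingRatio n k ≤ 1 :=
  (fallingRatio_antitone n (Nat.zero_le k)).trans (fallingRatio_zero n).le

lemma fallingRatio_le_exp {n : ℕ} (hn : 1 ≤ n) (k : ℕ) :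
    fallingRatio n k ≤ Real.exp (-((k : ℝ) * (k - 1) / (2 * n))) := by
  have hn' : (0 : ℝ) < n := by exact_mod_cast hn
  induction k with
  | zero => simp [fallingRatio_zero]
  | succ k ih =>
    have e : -(((k + 1 : ℕ) : ℝ) * ((k + 1 : ℕ) - 1) / (2 * n)) =
        -(k / n : ℝ) + -((k : ℝ) * (k - 1) / (2 * n)) := by
      push_cast; field_simp; ring
    rw [fallingRatio_succ, e, Real.exp_add]
    refine mul_le_mul ?_ ih (fallingRatio_nonneg _ _) (Real.exp_nonneg _)
    -- Each new factor is `1 - k / n ≤ exp (-k / n)`, or zero once `k ≥ n`.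
    rcases le_or_gt k n with h | h
    · rw [Nat.cast_sub h, sub_div, div_self hn'.ne']
      exact Real.one_sub_le_exp_neg _
    · rw [Nat.sub_eq_zero_of_le h.le]
      simp [Real.exp_nonneg]

/-- The inverse of a factor is `n / (n - j) = 1 + j / (n - j)`, which is at most `exp (j / (n - K))`
for `j ≤ K`. -/
lemma exp_le_fallingRatio {n K : ℕ} (hK : K < n) {k : ℕ} (hk : k ≤ K) :
    Real.exp (-((k : ℝ) * (k - 1) / (2 * (n - K)))) ≤ fallingRatio n k := by
  have hnK : (0 : ℝ) < n - K := by rw [sub_pos]; exact_mod_cast hK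
  have hn' : (0 : ℝ) < n := by exact_mod_cast (Nat.zero_le K).trans_lt hK
  induction k with
  | zero => simp [fallingRatio_zero]
  | succ k ih =>
    have e : -(((k + 1 : ℕ) : ℝ) * ((k + 1 : ℕ) - 1) / (2 * (n - K))) =
        -(k / (n - K) : ℝ) + -((k : ℝ) * (k - 1) / (2 * (n - K))) := by
      push_cast; field_simp; ring
    rw [fallingRatio_succ, e, Real.exp_add]
    refine mul_le_mul ?_ (ih (by omega)) (Real.exp_nonneg _) (by positivity)
    have hkK : (k : ℝ) ≤ K := by exact_mod_cast (by omega : k ≤ K)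
    rw [Nat.cast_sub (by omega), Real.exp_neg, inv_le_comm₀ (Real.exp_pos _) (by
      apply div_pos _ hn'; linarith), inv_div]
    have h1 : (n / (n - k) : ℝ) = k / (n - k) + 1 := by
      have : (n - k : ℝ) ≠ 0 := by linarith
      field_simp; ring
    rw [h1]
    refine le_trans ?_ (Real.add_one_le_exp _)
    gcongr

/-- For `k = ⌊x √n⌋` one has `k / √n → x` and `k / n → 0`, so the two exponential bounds have the
same limit. -/
lemma tendsto_fallingRatio_floor {x : ℝ} (hx : 0 < x) :
    Tendsto (fun n : ℕ => fallingRatio n ⌊x * √(n : ℝ)⌋₊) atTop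
      (𝓝 (Real.exp (-(1 / 2) * x ^ 2))) := by
  have hs : Tendsto (fun n : ℕ => √(n : ℝ)) atTop atTop :=
    Real.tendsto_sqrt_atTop.comp tendsto_natCast_atTop_atTop
  have hk : Tendsto (fun n : ℕ => (⌊x * √(n : ℝ)⌋₊ : ℝ) / √(n : ℝ)) atTop (𝓝 x) :=
    (tendsto_nat_floor_mul_div_atTop hx.le).comp hs
  have hinv : Tendsto (fun n : ℕ => (√(n : ℝ))⁻¹) atTop (𝓝 0) := tendsto_inv_atTop_zero.comp hs
  have hkn : Tendsto (fun n : ℕ => (⌊x * √(n : ℝ)⌋₊ : ℝ) / n) atTop (𝓝 0) := by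
    have := hk.mul hinv
    rw [mul_zero] at this
    refine this.congr fun n => ?_
    rw [← div_eq_mul_inv, div_div, Real.mul_self_sqrt (Nat.cast_nonneg n)]
  have hup : Tendsto (fun n : ℕ =>
      Real.exp (-((⌊x * √(n : ℝ)⌋₊ : ℝ) * (⌊x * √(n : ℝ)⌋₊ - 1) / (2 * n))))
      atTop (𝓝 (Real.exp (-(1 / 2) * x ^ 2))) := by
    refine (Real.continuous_exp.tendsto _).comp ?_
    have := ((hk.mul (hk.sub hinv)).div_const 2).neg
    have e : -(x * (x - 0) / 2) = -(1 / 2) * x ^ 2 := by ring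
    rw [e] at this
    refine this.congr' ?_
    filter_upwards [eventually_ge_atTop 1] with n hn
    have hn' : (0 : ℝ) < n := by exact_mod_cast hn
    have h2 := Real.sq_sqrt hn'.le
    have h3 := Real.sqrt_pos.2 hn'
    generalize (⌊x * √(n : ℝ)⌋₊ : ℝ) = k
    generalize √(n : ℝ) = s at *
    rw [← h2]
    field_simp
  have hlo : Tendsto (fun n : ℕ => Real.exp (-((⌊x * √(n : ℝ)⌋₊ : ℝ) * (⌊x * √(n : ℝ)⌋₊ - 1) /
      (2 * (n - ⌊x * √(n : ℝ)⌋₊))))) atTop (𝓝 (Real.exp (-(1 / 2) * x ^ 2))) := by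
    refine (Real.continuous_exp.tendsto _).comp ?_
    have := ((hk.mul (hk.sub hinv)).div ((hkn.const_sub 1).const_mul 2) (by norm_num)).neg
    have e : -(x * (x - 0) / (2 * (1 - 0))) = -(1 / 2) * x ^ 2 := by ring
    rw [e] at this
    refine this.congr' ?_
    filter_upwards [eventually_ge_atTop 1, hkn.eventually (gt_mem_nhds one_pos)] with n hn hlt
    have hn' : (0 : ℝ) < n := by exact_mod_cast hn
    have h2 := Real.sq_sqrt hn'.le
    have h3 := Real.sqrt_pos.2 hn'
    rw [div_lt_one hn'] at hlt
    simp only [Pi.div_apply]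
    generalize (⌊x * √(n : ℝ)⌋₊ : ℝ) = k at *
    generalize √(n : ℝ) = s at *
    rw [← h2] at hlt ⊢
    have h4 : s ^ 2 - k ≠ 0 := by linarith
    have h5 : 1 - k / s ^ 2 ≠ 0 := by
      rw [sub_ne_zero]
      intro h
      rw [eq_comm, div_eq_one_iff_eq (by positivity)] at h
      exact h4 (by linarith)
    field_simp
  refine tendsto_of_tendsto_of_tendsto_of_le_of_le' hlo hup ?_ ?_
  · filter_upwards [eventually_ge_atTop 1, hkn.eventually (gt_mem_nhds one_pos)] with n hn hlt
    have hn' : (0 : ℝ) < n := by exact_mod_cast hn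
    rw [div_lt_one hn'] at hlt
    exact exp_le_fallingRatio (by exact_mod_cast hlt) le_rfl
  · filter_upwards [eventually_ge_atTop 1] with n hn
    exact fallingRatio_le_exp hn _

/-- An integrable bound uniform in `n`, for dominated convergence. -/
lemma fallingRatio_floor_le {n : ℕ} (hn : 1 ≤ n) {x : ℝ} (hx : 0 < x) :
    fallingRatio n ⌊x * √(n : ℝ)⌋₊ ≤ Real.exp (9 / 4) * Real.exp (-(1 / 4) * x ^ 2) := by
  refine (fallingRatio_le_exp hn _).trans ?_
  rw [← Real.exp_add, Real.exp_le_exp]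
  have hn' : (1 : ℝ) ≤ n := by exact_mod_cast hn
  have h2 := Real.sq_sqrt (zero_le_one.trans hn')
  have h3 : 1 ≤ √(n : ℝ) := Real.one_le_sqrt.2 hn'
  have hy : 0 ≤ x * √(n : ℝ) := by positivity
  have hlt := Nat.lt_floor_add_one (x * √(n : ℝ))
  have hkk : (0 : ℝ) ≤ (⌊x * √(n : ℝ)⌋₊ : ℝ) * (⌊x * √(n : ℝ)⌋₊ - 1) := by
    rcases Nat.eq_zero_or_pos ⌊x * √(n : ℝ)⌋₊ with h | h
    · simp [h]
    · have : (1 : ℝ) ≤ ⌊x * √(n : ℝ)⌋₊ := by exact_mod_cast h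
      exact mul_nonneg (by linarith) (by linarith)
  have hk0 : (0 : ℝ) ≤ (⌊x * √(n : ℝ)⌋₊ : ℝ) := by positivity
  -- With `y = x √n` and `k > y - 1`, the product exceeds `(y - 1) (y - 2)` once `y > 3`; for `y ≤
  -- 3` the left side is not positive.
  have key : (x * √(n : ℝ)) ^ 2 - 3 * (x * √(n : ℝ)) ≤
      (⌊x * √(n : ℝ)⌋₊ : ℝ) * (⌊x * √(n : ℝ)⌋₊ - 1) := by
    generalize x * √(n : ℝ) = y at *
    generalize (⌊y⌋₊ : ℝ) = k at *
    rcases le_or_gt y 3 with h | h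
    · nlinarith
    · nlinarith
  have h4 : (x ^ 2 / 2 - 3 / 2 * x) ≤
      (⌊x * √(n : ℝ)⌋₊ : ℝ) * (⌊x * √(n : ℝ)⌋₊ - 1) / (2 * n) := by
    rw [le_div_iff₀ (by positivity)]
    refine le_trans ?_ key
    rw [mul_pow, h2]
    have : √(n : ℝ) ≤ n := by nlinarith
    nlinarith
  -- Completing the square: `x² / 2 - 3 x / 2 ≥ x² / 4 - 9 / 4`, the source of both constants in the
  -- bound.
  nlinarith [sq_nonneg (x / 2 - 3 / 2)]

lemma integral_fallingRatio_floor (n : ℕ) :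
    ∫ y in Set.Ioi (0 : ℝ), fallingRatio n ⌊y⌋₊ =
      ∫ y in (0 : ℝ)..(0 + (n + 1 : ℕ) : ℝ), fallingRatio n ⌊y⌋₊ := by
  rw [intervalIntegral.integral_of_le (by positivity)]
  refine (setIntegral_eq_of_subset_of_forall_sdiff_eq_zero measurableSet_Ioi
    Set.Ioc_subset_Ioi_self ?_)
  rintro y ⟨hy0, hy⟩
  refine fallingRatio_eq_zero (Nat.lt_of_succ_le (Nat.le_floor ?_))
  by_contra! h
  exact hy ⟨hy0, by simpa using h.le⟩

lemma antitone_fallingRatio_floor (n : ℕ) : Antitone fun y : ℝ => fallingRatio n ⌊y⌋₊ :=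
  fun _ _ h => fallingRatio_antitone n (Nat.floor_mono h)

/-- Ramanujan's `Q`-function (including the term `k = 0`). -/
noncomputable def ramanujanSum (n : ℕ) : ℝ := ∑ k ∈ Finset.range (n + 1), fallingRatio n k

lemma integral_le_ramanujanSum (n : ℕ) :
    ∫ y in Set.Ioi (0 : ℝ), fallingRatio n ⌊y⌋₊ ≤ ramanujanSum n := by
  rw [integral_fallingRatio_floor]
  refine (AntitoneOn.integral_le_sum ((antitone_fallingRatio_floor n).antitoneOn _)).trans_eq ?_
  simp [ramanujanSum]

lemma ramanujanSum_le_integral (n : ℕ) :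
    ramanujanSum n ≤ 1 + ∫ y in Set.Ioi (0 : ℝ), fallingRatio n ⌊y⌋₊ := by
  rw [integral_fallingRatio_floor]
  have h := AntitoneOn.sum_le_integral (x₀ := 0) (a := n + 1)
    ((antitone_fallingRatio_floor n).antitoneOn _)
  simp only [zero_add, Nat.floor_natCast] at h ⊢
  unfold ramanujanSum
  rw [Finset.sum_range_succ', fallingRatio_zero, add_comm]
  gcongr
  refine le_trans ?_ h
  exact Finset.sum_le_sum_of_subset_of_nonneg (Finset.range_mono n.le_succ)
    fun _ _ _ => fallingRatio_nonneg _ _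

/-- The substitution `y = x √n` absorbs the factor `√n`, and dominated convergence gives the
half-line Gaussian integral. -/
lemma tendsto_integral_fallingRatio :
    Tendsto (fun n : ℕ => (∫ y in Set.Ioi (0 : ℝ), fallingRatio n ⌊y⌋₊) / √(n : ℝ)) atTop
      (𝓝 (√(2 * Real.pi) / 2)) := by
  have h1 : √(2 * Real.pi) / 2 = ∫ x in Set.Ioi (0 : ℝ), Real.exp (-(1 / 2) * x ^ 2) := by
    rw [integral_gaussian_Ioi]
    congr 2
    ring
  have h2 : Tendsto (fun n : ℕ => ∫ x in Set.Ioi (0 : ℝ), fallingRatio n ⌊x * √(n : ℝ)⌋₊) atTop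
      (𝓝 (∫ x in Set.Ioi (0 : ℝ), Real.exp (-(1 / 2) * x ^ 2))) := by
    refine tendsto_integral_filter_of_dominated_convergence
      (fun x => Real.exp (9 / 4) * Real.exp (-(1 / 4) * x ^ 2)) ?_ ?_ ?_ ?_
    · refine Eventually.of_forall fun n => Measurable.aestronglyMeasurable ?_
      exact (measurable_from_nat (f := fallingRatio n)).comp
        (Nat.measurable_floor.comp (measurable_id.mul_const _))
    · filter_upwards [eventually_ge_atTop 1] with n hn
      refine (ae_restrict_iff' measurableSet_Ioi).2 (Eventually.of_forall fun x hx => ?_)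
      rw [Real.norm_of_nonneg (fallingRatio_nonneg _ _)]
      exact fallingRatio_floor_le hn hx
    · exact ((integrable_exp_neg_mul_sq (by norm_num)).const_mul _).integrableOn
    · exact (ae_restrict_iff' measurableSet_Ioi).2
        (Eventually.of_forall fun x hx => tendsto_fallingRatio_floor hx)
  rw [h1]
  refine h2.congr' ?_
  filter_upwards [eventually_ge_atTop 1] with n hn
  have hs : 0 < √(n : ℝ) := Real.sqrt_pos.2 (by exact_mod_cast hn)
  rw [integral_comp_mul_right_Ioi (fun y => fallingRatio n ⌊y⌋₊) 0 hs, zero_mul, smul_eq_mul,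
    div_eq_inv_mul]

lemma tendsto_div_sqrt_of_abs_sub_le {f g : ℕ → ℝ} {a C : ℝ}
    (hf : Tendsto (fun n : ℕ => f n / √(n : ℝ)) atTop (𝓝 a))
    (h : ∀ᶠ n in atTop, |g n - f n| ≤ C) :
    Tendsto (fun n : ℕ => g n / √(n : ℝ)) atTop (𝓝 a) := by
  have hs : Tendsto (fun n : ℕ => √(n : ℝ)) atTop atTop :=
    Real.tendsto_sqrt_atTop.comp tendsto_natCast_atTop_atTop
  have h0 : Tendsto (fun n : ℕ => (g n - f n) / √(n : ℝ)) atTop (𝓝 0) := by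
    refine squeeze_zero_norm' ?_ (hs.const_div_atTop C)
    filter_upwards [h] with n hn
    rw [norm_div, Real.norm_eq_abs, Real.norm_of_nonneg (Real.sqrt_nonneg _)]
    gcongr
  have := hf.add h0
  rw [add_zero] at this
  refine this.congr fun n => ?_
  ring

lemma tendsto_ramanujanSum :
    Tendsto (fun n : ℕ => ramanujanSum n / √(n : ℝ)) atTop (𝓝 (√(2 * Real.pi) / 2)) := by
  refine tendsto_div_sqrt_of_abs_sub_le (C := 1) tendsto_integral_fallingRatio
    (Eventually.of_forall fun n => ?_)
  have h1 := integral_le_ramanujanSum n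
  have h2 := ramanujanSum_le_integral n
  rw [abs_le]
  constructor <;> linarith

lemma sum_Icc_three_fallingRatio {n : ℕ} (hn : 3 ≤ n) :
    |∑ l ∈ Finset.Icc 3 n, fallingRatio n l - ramanujanSum n| ≤ 3 := by
  have h : ramanujanSum n = ∑ k ∈ Finset.range 3, fallingRatio n k +
      ∑ l ∈ Finset.Icc 3 n, fallingRatio n l := by
    unfold ramanujanSum
    rw [← Finset.sum_range_add_sum_Ico _ (by omega : 3 ≤ n + 1)]
    rfl
  have h0 : 0 ≤ ∑ k ∈ Finset.range 3, fallingRatio n k :=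
    Finset.sum_nonneg fun _ _ => fallingRatio_nonneg _ _
  have h3 : ∑ k ∈ Finset.range 3, fallingRatio n k ≤ ∑ k ∈ Finset.range 3, 1 :=
    Finset.sum_le_sum fun _ _ => fallingRatio_le_one _ _
  simp only [Finset.sum_const, Finset.card_range, nsmul_eq_mul, Nat.cast_ofNat, mul_one] at h3
  rw [h, abs_le]
  constructor <;> linarith

/-- By monotonicity `2 t(2k)` lies between `t(2k) + t(2k+1)` and `t(2k-1) + t(2k)`. The 4 pays for
the terms `t 0`, …, `t 3`, which the even sum starting at `k = 2` does not cover. -/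
lemma abs_two_mul_sum_even_sub_le {t : ℕ → ℝ} (ht : Antitone t) (h0 : ∀ k, 0 ≤ t k)
    (h1 : ∀ k, t k ≤ 1) {m : ℕ} (hm : 1 ≤ m) :
    |2 * ∑ k ∈ Finset.Icc 2 m, t (2 * k) - ∑ k ∈ Finset.range (2 * m + 1), t k| ≤ 4 := by
  have key : ∑ k ∈ Finset.range (2 * m + 2), t k ≤ 2 * ∑ k ∈ Finset.Icc 2 m, t (2 * k) + 4 ∧
      2 * ∑ k ∈ Finset.Icc 2 m, t (2 * k) ≤ ∑ k ∈ Finset.range (2 * m + 1), t k := by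
    induction m, hm using Nat.le_induction with
    | base =>
      simp only [Finset.sum_range_succ, Finset.sum_range_zero, mul_one, zero_add,
        Finset.Icc_eq_empty_of_lt one_lt_two, Finset.sum_empty]
      constructor <;> linarith [h0 0, h1 0, h0 1, h1 1, h0 2, h1 2, h1 3]
    | succ m hm ih =>
      rw [Finset.sum_Icc_succ_top (by omega), mul_add 2 m 1, mul_one,
        Finset.sum_range_succ _ (2 * m + 2 + 1), Finset.sum_range_succ _ (2 * m + 2)]
      rw [Finset.sum_range_succ _ (2 * m + 1)] at ih ⊢
      have a1 := ht (by omega : 2 * m + 2 ≤ 2 * m + 2 + 1)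
      have a2 := ht (by omega : 2 * m + 1 ≤ 2 * m + 2)
      constructor <;> linarith [ih.1, ih.2]
  rw [Finset.sum_range_succ] at key
  rw [abs_le]
  constructor <;> linarith [h0 (2 * m + 1), key.1, key.2]

lemma sum_even_fallingRatio {n : ℕ} (hn : 2 ≤ n) :
    |2 * ∑ k ∈ Finset.Icc 2 (n / 2), fallingRatio n (2 * k) - ramanujanSum n| ≤ 5 := by
  have h := abs_two_mul_sum_even_sub_le (fallingRatio_antitone n) (fallingRatio_nonneg n)
    (fallingRatio_le_one n) (m := n / 2) (by omega)
  -- For odd `n` the truncated sum misses the single term `k = n`.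
  have h2 : |∑ k ∈ Finset.range (2 * (n / 2) + 1), fallingRatio n k - ramanujanSum n| ≤ 1 := by
    unfold ramanujanSum
    rcases Nat.even_or_odd' n with ⟨m, rfl | rfl⟩
    · rw [Nat.mul_div_cancel_left m two_pos]; simp
    · rw [show (2 * m + 1) / 2 = m by omega, Finset.sum_range_succ _ (2 * m + 1),
        sub_add_cancel_left, abs_neg, abs_of_nonneg (fallingRatio_nonneg _ _)]
      exact fallingRatio_le_one _ _
  refine (abs_sub_le _ _ _).trans ((add_le_add h h2).trans_eq (by norm_num))

end Ramanujan

/-! ### Exact formulas and the final asymptotics -/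

section Main

lemma card_cycleMaps_fin {n l : ℕ} (hl : 1 ≤ l) (hln : l ≤ n) :
    ((cycleMaps (Fin n) l).card : ℝ) = (n : ℝ) ^ (n - 1) * fallingRatio n l := by
  have h := card_cycleMaps (V := Fin n) hl (by simpa using hln)
  rw [Fintype.card_fin] at h
  have hn : (n : ℝ) ≠ 0 := by
    have : n ≠ 0 := by omega
    exact_mod_cast this
  have hd := Nat.factorial_mul_descFactorial hln
  rw [← hd] at h
  have h1 : (cycleMaps (Fin n) l).card * n = n.descFactorial l * n ^ (n - l) :=
    Nat.eq_of_mul_eq_mul_left (Nat.factorial_pos (n - l)) (by linarith)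
  have h2 : ((cycleMaps (Fin n) l).card : ℝ) * n = n.descFactorial l * (n : ℝ) ^ (n - l) := by
    exact_mod_cast h1
  refine mul_right_cancel₀ hn (h2.trans ?_)
  have e1 : (n : ℝ) ^ (n - 1) * n = (n : ℝ) ^ (n - l) * (n : ℝ) ^ l := by
    rw [← pow_succ, ← pow_add]
    congr 1
    omega
  unfold fallingRatio
  rw [mul_right_comm, e1]
  field_simp

lemma sum_filter_even_Icc (g : ℕ → ℝ) (n : ℕ) :
    ∑ l ∈ (Finset.Icc 3 n).filter Even, g l = ∑ k ∈ Finset.Icc 2 (n / 2), g (2 * k) := by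
  refine (Finset.sum_nbij' (fun k => 2 * k) (fun l => l / 2) ?_ ?_ ?_ ?_ ?_).symm
  · intro k hk
    simp only [Finset.mem_Icc, Finset.mem_filter] at hk ⊢
    exact ⟨by omega, even_two_mul k⟩
  · intro l hl
    simp only [Finset.mem_Icc, Finset.mem_filter] at hl ⊢
    obtain ⟨⟨h1, h2⟩, m, rfl⟩ := hl
    omega
  · intro k _
    simp
  · intro l hl
    exact Nat.two_mul_div_two_of_even (Finset.mem_filter.1 hl).2
  · intro k _
    rfl

lemma numConnectedBipartite_one_eq (n : ℕ) :
    (numConnectedBipartite n 1 : ℝ) =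
      (n : ℝ) ^ (n - 1) * ∑ k ∈ Finset.Icc 2 (n / 2), fallingRatio n (2 * k) := by
  rw [numConnectedBipartite_eq_sum, Nat.cast_sum, Finset.mul_sum, sum_filter_even_Icc]
  refine Finset.sum_congr rfl fun k hk => card_cycleMaps_fin ?_ ?_ <;>
  · rw [Finset.mem_Icc] at hk
    omega

lemma numConnected_one_eq (n : ℕ) :
    (numConnected n 1 : ℝ) =
      (n : ℝ) ^ (n - 1) * ((∑ l ∈ Finset.Icc 3 n, fallingRatio n l) / 2) := by
  have h : (2 : ℝ) * numConnected n 1 = ∑ l ∈ Finset.Icc 3 n, ((cycleMaps (Fin n) l).card : ℝ) := by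
    exact_mod_cast two_mul_numConnected n
  rw [Finset.sum_congr rfl fun l hl => card_cycleMaps_fin (by linarith [(Finset.mem_Icc.1 hl).1])
    (Finset.mem_Icc.1 hl).2, ← Finset.mul_sum] at h
  linarith

lemma isEquivalent_of_tendsto_div_sqrt {f g : ℕ → ℝ} {c : ℝ} (hc : c ≠ 0)
    (hf : ∀ n : ℕ, f n = (n : ℝ) ^ (n - 1) * g n)
    (hg : Tendsto (fun n : ℕ => g n / √(n : ℝ)) atTop (𝓝 c)) :
    Asymptotics.IsEquivalent atTop f (fun n : ℕ => c * (n : ℝ) ^ ((n : ℝ) - 1 / 2)) := by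
  refine Asymptotics.isEquivalent_of_tendsto_one ?_
  have h := hg.div_const c
  rw [div_self hc] at h
  refine h.congr' ?_
  filter_upwards [eventually_ge_atTop 1] with n hn
  have hn' : (0 : ℝ) < n := by exact_mod_cast hn
  have e : (n : ℝ) ^ ((n : ℝ) - 1 / 2) = (n : ℝ) ^ (n - 1) * √(n : ℝ) := by
    rw [Real.sqrt_eq_rpow, ← Real.rpow_natCast, ← Real.rpow_add hn', Nat.cast_sub hn]
    congr 1
    push_cast
    ring
  have hs : 0 < √(n : ℝ) := Real.sqrt_pos.2 hn'
  rw [Pi.div_apply, hf, e]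
  field_simp

lemma sqrt_two_mul_pi_div_four : √(2 * Real.pi) / 2 / 2 = √(Real.pi / 8) := by
  rw [show Real.pi / 8 = 2 * Real.pi / 4 ^ 2 by ring, Real.sqrt_div (by positivity),
    Real.sqrt_sq (by norm_num)]
  ring

lemma sqrt_pi_div_eight_ne_zero : √(Real.pi / 8) ≠ 0 :=
  (Real.sqrt_pos.2 (by positivity)).ne'

end Main

theorem theorem1p3 :
    (∀ n : ℕ, 4 ≤ n →
      (numConnectedBipartite n 1 : ℝ) =
        (n : ℝ) ^ (n - 1) *
          ∑ k ∈ Finset.Icc 2 (n / 2),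
            (n.factorial : ℝ) / (((n - 2 * k).factorial : ℝ) * (n : ℝ) ^ (2 * k))) ∧
    Asymptotics.IsEquivalent Filter.atTop
      (fun n : ℕ => (numConnectedBipartite n 1 : ℝ))
      (fun n : ℕ => Real.sqrt (Real.pi / 8) * (n : ℝ) ^ ((n : ℝ) - 1 / 2)) ∧
    Asymptotics.IsEquivalent Filter.atTop
      (fun n : ℕ => (numConnected n 1 : ℝ))
      (fun n : ℕ => Real.sqrt (Real.pi / 8) * (n : ℝ) ^ ((n : ℝ) - 1 / 2)) := by
  refine ⟨fun n _ => ?_, ?_, ?_⟩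
  · rw [numConnectedBipartite_one_eq]
    congr 1
    refine Finset.sum_congr rfl fun k hk => ?_
    rw [Finset.mem_Icc] at hk
    have hd := Nat.factorial_mul_descFactorial (n := n) (k := 2 * k) (by omega)
    rw [fallingRatio, ← hd, Nat.cast_mul, mul_div_mul_left _ _ (by positivity)]
  · refine isEquivalent_of_tendsto_div_sqrt sqrt_pi_div_eight_ne_zero
      numConnectedBipartite_one_eq ?_
    -- Here the division by 2 reflects that only even cycle lengths contribute.
    have h := (tendsto_div_sqrt_of_abs_sub_le (C := 5) tendsto_ramanujanSum
      ((eventually_ge_atTop 2).mono fun n hn => sum_even_fallingRatio hn)).div_const 2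
    rw [sqrt_two_mul_pi_div_four] at h
    refine h.congr fun n => ?_
    ring
  · refine isEquivalent_of_tendsto_div_sqrt sqrt_pi_div_eight_ne_zero numConnected_one_eq ?_
    -- Here the division by 2 comes from the two orientations of each graph.
    have h := (tendsto_div_sqrt_of_abs_sub_le (C := 3) tendsto_ramanujanSum
      ((eventually_ge_atTop 3).mono fun n hn => sum_Icc_three_fallingRatio hn)).div_const 2
    rw [sqrt_two_mul_pi_div_four] at h
    refine h.congr fun n => ?_
    ring
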